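/- Let $m,n\ge 2$ be integers. An $m\times n$ chessboard with an integer written on each cell has the neighbour-sum property if the number on each cell equals the sum of the numbers on its neighbouring cells, where two distinct cells are neighbours if they share a common edge or a common vertex (the Moore neighbourhood). It is non-trivial if not all of its entries are zero. Then a non-trivial $m\times n$ chessboard with the neighbour-sum property exists if and only if $2\mid m+1$ and $3\mid n+1$, or $3\mid m+1$ and $2\mid n+1$. -/

import Mathlib

/-- The cells of an `m × n` chessboard: row index in `Fin m`, column index in `Fin n`. -/
abbrev Cell (m n : ℕ) : Type := Fin m × Fin n

/-- Two cells are (Moore) neighbours if they are distinct and share a common edge or a common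
vertex, i.e. both their row indices and their column indices differ by at most one. -/
def IsNeighbour {m n : ℕ} (a b : Cell m n) : Prop :=
  a ≠ b ∧ |(a.1 : ℤ) - (b.1 : ℤ)| ≤ 1 ∧ |(a.2 : ℤ) - (b.2 : ℤ)| ≤ 1

instance {m n : ℕ} (a b : Cell m n) : Decidable (IsNeighbour a b) :=
  inferInstanceAs (Decidable (_ ∧ _ ∧ _))

/-- An integer filling of the board has the neighbour-sum property if the number on each cell is
the sum of the numbers on the neighbouring cells. -/
def NeighbourSum {m n : ℕ} (X : Cell m n → ℤ) : Prop :=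
  ∀ a : Cell m n, X a = ∑ b with IsNeighbour a b, X b

/-!
On the space of `m × n` matrices the neighbour-sum property reads `A X B = 2 X`, where `A` and `B`
are the adjacency matrices of the paths with a loop at every vertex. Left multiplication by `A` and
right multiplication by `B` commute, so over an algebraically closed field there is a common
eigenvector, that is, eigenvalues `a` of `A` and `b` of `B` with `a * b = 2`. Solving the recurrence
gives `a = 1 + x + x⁻¹` and `b = 1 + y + y⁻¹` with `x ^ (2 * (m + 1)) = 1 = y ^ (2 * (n + 1))` and
`x`, `y` different from `±1`.

It remains to find all roots of unity with `(1 + x + x⁻¹) * (1 + y + y⁻¹) = 2`. Let `v` be a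
valuation with `v 2 < 1`. Since `1 - x ^ 3 = x * (1 + x + x⁻¹) * (1 - x)`, the size of
`1 + x + x⁻¹` is at least that of `1 - x ^ 3`, which is `1` unless `x ^ 3` has order `2 ^ (j + 1)`,
and then its `2 ^ j`-th power is `v 2`. So `v (1 + x + x⁻¹) ^ 2 > v 2`, apart from the cases
`1 + x + x⁻¹ = 2` and `1 + x + x⁻¹ = 1 ± √3`. As the product of the two factors has size `v 2`, one
factor is `2`, and the other `1`, or both are `1 ± √3`, which is impossible.

Conversely, the outer product of eigenvectors of `A` and `B` whose eigenvalues are `1` and `2`, in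
either order, satisfies `A X B = 2 X`.
-/

section RootsOfUnity

variable {R Γ : Type*} [CommRing R] [LinearOrderedCommGroupWithZero Γ] (v : Valuation R Γ)

lemma valuation_eq_one_of_isOfFinOrder {z : R} (hz : IsOfFinOrder z) : v z = 1 := by
  rw [← pow_eq_one_iff_of_nonneg zero_le hz.orderOf_pos.ne', ← map_pow, pow_orderOf_eq_one, map_one]

lemma valuation_one_sub_pow_le {z : R} (hz : v z ≤ 1) (n : ℕ) : v (1 - z ^ n) ≤ v (1 - z) := by
  rw [← mul_neg_geom_sum z n, map_mul]
  exact mul_le_of_le_one_right' (v.map_sum_le fun i _ => (v.integer.pow_mem hz i :))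

lemma valuation_natCast_eq_one_of_odd (h2 : v 2 < 1) {n : ℕ} (hn : Odd n) : v n = 1 := by
  obtain ⟨k, rfl⟩ := hn
  have hk : v (2 * k) < 1 := by
    rw [map_mul]
    exact (mul_le_of_le_one_right' (natCast_mem v.integer k)).trans_lt h2
  push_cast
  rw [add_comm, v.map_one_add_of_lt hk]

lemma eq_one_of_odd_orderOf_of_valuation_one_sub_lt_one [IsDomain R] (h2 : v 2 < 1) {z : R}
    (hodd : Odd (orderOf z)) (hz : v (1 - z) < 1) : z = 1 := by
  by_contra hne
  have hvz : v z = 1 := valuation_eq_one_of_isOfFinOrder v (orderOf_pos_iff.1 hodd.pos)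
  have hsum : ∑ i ∈ Finset.range (orderOf z), z ^ i = 0 := by
    have h := mul_neg_geom_sum z (orderOf z)
    rw [pow_orderOf_eq_one, sub_self] at h
    exact (mul_eq_zero.1 h).resolve_left (sub_ne_zero.2 (Ne.symm hne))
  have hlt : v (∑ i ∈ Finset.range (orderOf z), (1 - z ^ i)) < 1 :=
    v.map_sum_lt one_ne_zero fun i _ => (valuation_one_sub_pow_le v hvz.le i).trans_lt hz
  rw [Finset.sum_sub_distrib, hsum, sub_zero, Finset.sum_const, Finset.card_range, nsmul_one,
    valuation_natCast_eq_one_of_odd v h2 hodd] at hlt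
  exact hlt.false

lemma exists_two_pow_eq_neg_one [NoZeroDivisors R] {z : R} (hz : z ≠ 1) {k : ℕ}
    (hk : z ^ 2 ^ k = 1) : ∃ j : ℕ, z ^ 2 ^ j = -1 := by
  induction k with
  | zero => exact absurd (by simpa only [pow_zero, pow_one] using hk) hz
  | succ k ih =>
    rw [pow_succ, pow_mul, sq_eq_one_iff] at hk
    exact hk.elim ih fun h => ⟨k, h⟩

lemma exists_two_pow_eq_neg_one_of_valuation_one_sub_lt_one [IsDomain R] (h2 : v 2 < 1) {z : R}
    (hfin : IsOfFinOrder z) (hne : z ≠ 1) (hz : v (1 - z) < 1) : ∃ j : ℕ, z ^ 2 ^ j = -1 := by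
  obtain ⟨k, N, hN, hkN⟩ := Nat.exists_eq_two_pow_mul_odd hfin.orderOf_pos.ne'
  have horder : orderOf (z ^ 2 ^ k) = N := by
    rw [orderOf_pow_of_dvd (by positivity) ⟨N, hkN⟩, hkN, Nat.mul_div_cancel_left _ (by positivity)]
  have hlt : v (1 - z ^ 2 ^ k) < 1 :=
    (valuation_one_sub_pow_le v (valuation_eq_one_of_isOfFinOrder v hfin).le _).trans_lt hz
  exact exists_two_pow_eq_neg_one hne
    (eq_one_of_odd_orderOf_of_valuation_one_sub_lt_one v h2 (horder ▸ hN) hlt)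

lemma isOfFinOrder_of_pow_eq_neg_one {z : R} {k : ℕ} (hk : k ≠ 0) (hz : z ^ k = -1) :
    IsOfFinOrder z := by
  refine .of_pow (n := k) (isOfFinOrder_iff_pow_eq_one.2 ⟨2, two_pos, ?_⟩) hk
  rw [hz, neg_one_sq]

lemma valuation_one_add_le_of_pow_eq_neg_one {z : R} {k : ℕ} (hk : k ≠ 0)
    (hz : z ^ k = -1) : v (1 + z) ≤ v (1 - z) := by
  have hvz : v z = 1 :=
    valuation_eq_one_of_isOfFinOrder v (isOfFinOrder_of_pow_eq_neg_one hk hz)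
  simpa only [pow_succ, hz, neg_one_mul, sub_neg_eq_add] using
    valuation_one_sub_pow_le v hvz.le (k + 1)

lemma valuation_one_sub_sq_of_even_of_pow_eq_neg_one {z : R} {k : ℕ} (hk : k ≠ 0) (heven : Even k)
    (hz : z ^ k = -1) : v (1 - z ^ 2) = v (1 - z) ^ 2 := by
  have hle : v (1 + z) ≤ v (1 - z) := valuation_one_add_le_of_pow_eq_neg_one v hk hz
  have hge : v (1 - z) ≤ v (1 + z) := by
    have h := valuation_one_add_le_of_pow_eq_neg_one v hk ((heven.neg_pow z).trans hz)
    rwa [← sub_eq_add_neg, sub_neg_eq_add] at h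
  rw [show 1 - z ^ 2 = (1 - z) * (1 + z) by ring, map_mul, hle.antisymm hge, sq]

lemma valuation_one_sub_pow_two_pow {z : R} {j : ℕ} (hz : z ^ 2 ^ j = -1) :
    v (1 - z) ^ 2 ^ j = v 2 := by
  induction j generalizing z with
  | zero =>
    obtain rfl : z = -1 := by simpa only [pow_zero, pow_one] using hz
    norm_num
  | succ j ih =>
    have heven : Even (2 ^ (j + 1)) := even_two.pow_of_ne_zero j.succ_ne_zero
    rw [pow_succ', pow_mul,
      ← valuation_one_sub_sq_of_even_of_pow_eq_neg_one v (by positivity) heven hz]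
    exact ih (by rw [← pow_mul, ← pow_succ', hz])

end RootsOfUnity

section Field

variable {K : Type*} [Field K]

lemma exists_valuationSubring_natCast_lt_one (K : Type*) [Field K] [CharZero K] {n : ℕ}
    (hn : n ≠ 1) : ∃ B : ValuationSubring K, B.valuation n < 1 := by
  let Z : Subring K := (Int.castRingHom K).range
  have hI : Ideal.span {(n : Z)} ≠ ⊤ := by
    rw [Ne, Ideal.span_singleton_eq_top]
    intro hunit
    obtain ⟨⟨_, c, rfl⟩, hc⟩ := hunit.exists_right_inv
    have hK : (n : K) * (c : K) = 1 := congrArg Subtype.val hc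
    have hZ : (n : ℤ) * c = 1 := by exact_mod_cast hK
    exact hn (by exact_mod_cast Int.eq_one_of_mul_eq_one_right n.cast_nonneg hZ)
  obtain ⟨B, -, hB⟩ := Ideal.image_subset_nonunits_valuationSubring _ hI
  exact ⟨B, hB ⟨n, Ideal.subset_span rfl, rfl⟩⟩

lemma add_inv_eq_one_of_pow_three_eq_neg_one {x : K} (hx : x ^ 3 = -1) (hne : x ≠ -1) :
    x + x⁻¹ = 1 := by
  have hx0 : x ≠ 0 := by rintro rfl; simp at hx
  have hfactor : (x + 1) * (x ^ 2 - x + 1) = 0 := by linear_combination hx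
  have hquad := (mul_eq_zero.1 hfactor).resolve_left fun h => hne (eq_neg_of_add_eq_zero_left h)
  field_simp
  linear_combination hquad

lemma add_inv_eq_zero_or_sq_eq_three_of_pow_six_eq_neg_one {x : K} (hx : x ^ 6 = -1) :
    x + x⁻¹ = 0 ∨ (x + x⁻¹) ^ 2 = 3 := by
  have hx0 : x ≠ 0 := by rintro rfl; simp at hx
  have hfactor : (x ^ 2 + 1) * (x ^ 4 - x ^ 2 + 1) = 0 := by linear_combination hx
  refine (mul_eq_zero.1 hfactor).imp (fun h => ?_) fun h => ?_
  · field_simp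
    linear_combination h
  · field_simp
    linear_combination h

lemma one_add_mul_one_add_ne_two_of_sq_eq_three [NeZero (2 : K)] {s t : K} (hs : s ^ 2 = 3)
    (ht : t ^ 2 = 3) : (1 + s) * (1 + t) ≠ 2 := by
  intro h
  have h2 : (2 : K) ≠ 0 := two_ne_zero
  rcases sq_eq_sq_iff_eq_or_eq_neg.1 (ht.trans hs.symm) with rfl | rfl
  · have ht1 : t = -1 := mul_left_cancel₀ h2 (by linear_combination h - ht)
    subst ht1
    exact h2 (by linear_combination -hs)
  · exact mul_ne_zero h2 h2 (by linear_combination -h - hs)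

lemma one_sub_pow_three_eq_mul {x : K} (hx : x ≠ 0) :
    1 - x ^ 3 = x * (1 + (x + x⁻¹)) * (1 - x) := by
  field_simp
  ring

section Valuation

variable {Γ : Type*} [LinearOrderedCommGroupWithZero Γ] (v : Valuation K Γ)

lemma valuation_one_sub_pow_three_le {x : K} (hx : v x = 1) :
    v (1 - x ^ 3) ≤ v (1 + (x + x⁻¹)) := by
  have hx0 : x ≠ 0 := v.ne_zero_iff.1 (hx ▸ one_ne_zero)
  rw [one_sub_pow_three_eq_mul hx0, map_mul, map_mul, hx, one_mul]
  exact mul_le_of_le_one_right' (v.map_sub_le v.map_one.le hx.le)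

lemma valuation_two_lt_one_sub_sq [NeZero (2 : K)] (h2 : v 2 < 1) {z : K} {j : ℕ} (hj : 2 ≤ j)
    (hz : z ^ 2 ^ j = -1) : v 2 < v (1 - z) ^ 2 := by
  obtain ⟨i, rfl⟩ := Nat.exists_eq_add_of_le' hj
  have hpow : (v (1 - z) ^ 2) ^ 2 ^ (i + 1) = v 2 := by
    rw [← pow_mul, ← pow_succ', valuation_one_sub_pow_two_pow v hz]
  have hlt : v (1 - z) ^ 2 < 1 := (pow_lt_one_iff (by positivity)).1 (hpow ▸ h2)
  have hpos : 0 < v (1 - z) ^ 2 := by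
    refine zero_lt_iff.2 fun h0 => v.ne_zero_iff.2 (two_ne_zero (α := K)) ?_
    rw [← hpow, h0, zero_pow (by positivity)]
  exact hpow ▸ pow_lt_self_of_lt_one₀ hpos hlt (Nat.one_lt_two_pow i.succ_ne_zero)

lemma add_inv_eq_one_or_valuation_two_lt_or_sq_eq_three [NeZero (2 : K)] (h2 : v 2 < 1) {x : K}
    (hx : IsOfFinOrder x) (hx2 : x ^ 2 ≠ 1) (hne : 1 + (x + x⁻¹) ≠ 0) :
    x + x⁻¹ = 1 ∨ v 2 < v (1 + (x + x⁻¹)) ^ 2 ∨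
      ((x + x⁻¹) ^ 2 = 3 ∧ v 2 ≤ v (1 + (x + x⁻¹)) ^ 2) := by
  have hle : v (1 - x ^ 3) ^ 2 ≤ v (1 + (x + x⁻¹)) ^ 2 := pow_le_pow_left₀ zero_le
    (valuation_one_sub_pow_three_le v (valuation_eq_one_of_isOfFinOrder v hx)) 2
  rcases le_or_gt 1 (v (1 - x ^ 3)) with hge | hlt
  · exact .inr (.inl (h2.trans_le ((one_le_pow₀ hge).trans hle)))
  have hx3 : x ^ 3 ≠ 1 := by
    have hx1 : 1 - x ≠ 0 := sub_ne_zero.2 fun h => hx2 (by rw [← h, one_pow])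
    rw [ne_comm, ← sub_ne_zero, one_sub_pow_three_eq_mul hx.isUnit.ne_zero]
    exact mul_ne_zero (mul_ne_zero hx.isUnit.ne_zero hne) hx1
  obtain ⟨j, hj⟩ :=
    exists_two_pow_eq_neg_one_of_valuation_one_sub_lt_one v h2 hx.pow hx3 hlt
  match j with
  | 0 =>
    have hxneg : x ≠ -1 := fun h => hx2 (by rw [h, neg_one_sq])
    exact .inl (add_inv_eq_one_of_pow_three_eq_neg_one (by simpa only [pow_zero, pow_one] using hj)
      hxneg)
  | 1 =>
    have hv2 : v 2 ≤ v (1 + (x + x⁻¹)) ^ 2 := (valuation_one_sub_pow_two_pow v hj).symm.trans_le hle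
    rw [pow_one, ← pow_mul] at hj
    refine (add_inv_eq_zero_or_sq_eq_three_of_pow_six_eq_neg_one hj).elim
      (fun h0 => ?_) fun h3 => .inr (.inr ⟨h3, hv2⟩)
    right; left
    rwa [h0, add_zero, map_one, one_pow]
  | j + 2 => exact .inr (.inl ((valuation_two_lt_one_sub_sq v h2 (by lia) hj).trans_le hle))

end Valuation

lemma add_inv_eq_of_one_add_mul_one_add_eq_two [CharZero K] {x y : K} (hx : IsOfFinOrder x)
    (hy : IsOfFinOrder y) (hx2 : x ^ 2 ≠ 1) (hy2 : y ^ 2 ≠ 1)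
    (h : (1 + (x + x⁻¹)) * (1 + (y + y⁻¹)) = 2) :
    (x + x⁻¹ = 1 ∧ y + y⁻¹ = 0) ∨ (x + x⁻¹ = 0 ∧ y + y⁻¹ = 1) := by
  obtain ⟨B, h2⟩ := exists_valuationSubring_natCast_lt_one K (n := 2) (by decide)
  rw [Nat.cast_ofNat] at h2
  have hcases {z : K} := add_inv_eq_one_or_valuation_two_lt_or_sq_eq_three B.valuation h2 (x := z)
  have hprod : B.valuation (1 + (x + x⁻¹)) ^ 2 * B.valuation (1 + (y + y⁻¹)) ^ 2 =
      B.valuation 2 * B.valuation 2 := by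
    rw [← mul_pow, ← map_mul, h, sq]
  have hpos : 0 < B.valuation 2 := B.valuation.pos_iff.2 two_ne_zero
  rcases hcases hx hx2 (left_ne_zero_of_mul (h ▸ two_ne_zero)) with hs | hs
  · exact .inl ⟨hs, by linear_combination h / 2 - (1 + (y + y⁻¹)) / 2 * hs⟩
  rcases hcases hy hy2 (right_ne_zero_of_mul (h ▸ two_ne_zero)) with ht | ht
  · exact .inr ⟨by linear_combination h / 2 - (1 + (x + x⁻¹)) / 2 * ht, ht⟩
  exfalso
  rcases hs, ht with ⟨hs | ⟨hs3, hs⟩, ht | ⟨ht3, ht⟩⟩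
  · exact (mul_lt_mul hs ht.le hpos zero_le).ne' hprod
  · exact (mul_lt_mul hs ht hpos zero_le).ne' hprod
  · exact (mul_lt_mul' hs ht zero_le (hpos.trans_le hs)).ne' hprod
  · exact one_add_mul_one_add_ne_two_of_sq_eq_three hs3 ht3 h

lemma two_dvd_of_add_inv_eq_zero {x : K} {k : ℕ} (hx0 : x ≠ 0) (hx : (x ^ 2) ^ k = 1)
    (hx2 : x ^ 2 ≠ 1) (h : x + x⁻¹ = 0) : 2 ∣ k := by
  have hsq : x ^ 2 = -1 := by field_simp at h; linear_combination h
  rw [← orderOf_eq_prime (p := 2) (by rw [hsq, neg_one_sq]) hx2]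
  exact orderOf_dvd_of_pow_eq_one hx

lemma three_dvd_of_add_inv_eq_one {x : K} {k : ℕ} (hx : (x ^ 2) ^ k = 1)
    (hx2 : x ^ 2 ≠ 1) (h : x + x⁻¹ = 1) : 3 ∣ k := by
  have hx0 : x ≠ 0 := by rintro rfl; simp at h
  have hquad : x ^ 2 - x + 1 = 0 := by field_simp at h; linear_combination h
  rw [← orderOf_eq_prime (p := 3) (by linear_combination (x ^ 4 + x ^ 3 - x - 1) * hquad) hx2]
  exact orderOf_dvd_of_pow_eq_one hx

lemma dvd_and_dvd_or_of_one_add_mul_one_add_eq_two [CharZero K] {x y : K} {k l : ℕ} (hk : k ≠ 0)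
    (hl : l ≠ 0) (hx : (x ^ 2) ^ k = 1) (hy : (y ^ 2) ^ l = 1) (hx2 : x ^ 2 ≠ 1) (hy2 : y ^ 2 ≠ 1)
    (h : (1 + (x + x⁻¹)) * (1 + (y + y⁻¹)) = 2) : (2 ∣ k ∧ 3 ∣ l) ∨ (3 ∣ k ∧ 2 ∣ l) := by
  have hfin {z : K} {r : ℕ} (hr : r ≠ 0) (hz : (z ^ 2) ^ r = 1) : IsOfFinOrder z :=
    .of_pow (isOfFinOrder_iff_pow_eq_one.2 ⟨r, hr.pos, hz⟩) two_ne_zero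
  have hxfin := hfin hk hx
  have hyfin := hfin hl hy
  rcases add_inv_eq_of_one_add_mul_one_add_eq_two hxfin hyfin hx2 hy2 h with ⟨hs, ht⟩ | ⟨hs, ht⟩
  · exact .inr ⟨three_dvd_of_add_inv_eq_one hx hx2 hs,
      two_dvd_of_add_inv_eq_zero hyfin.isUnit.ne_zero hy hy2 ht⟩
  · exact .inl ⟨two_dvd_of_add_inv_eq_zero hxfin.isUnit.ne_zero hx hx2 hs,
      three_dvd_of_add_inv_eq_one hy hy2 ht⟩

open Polynomial in
lemma exists_add_inv_eq [IsAlgClosed K] (c : K) : ∃ x : K, x ≠ 0 ∧ x + x⁻¹ = c := by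
  obtain ⟨x, hx⟩ := IsAlgClosed.exists_root (C 1 * X ^ 2 + C (-c) * X + C 1)
    (by rw [degree_quadratic one_ne_zero]; decide)
  have hquad : x ^ 2 - c * x + 1 = 0 := by simpa [IsRoot.def, ← sub_eq_add_neg] using hx
  have hx0 : x ≠ 0 := by rintro rfl; simp at hquad
  refine ⟨x, hx0, ?_⟩
  field_simp
  linear_combination hquad

lemma mul_pow_eq_geom_sum_of_recurrence {u : ℕ → K} {m : ℕ} {x : K} (hx : x ≠ 0) (h0 : u 0 = 0)
    (hrec : ∀ i < m, u (i + 2) = (x + x⁻¹) * u (i + 1) - u i) {k : ℕ} (hk : k ≤ m + 1) :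
    u k * x ^ k = u 1 * x * ∑ i ∈ Finset.range k, (x ^ 2) ^ i := by
  induction k using Nat.twoStepInduction with
  | zero => simp [h0]
  | one => simp
  | more k ih ih' =>
    have hxx : (x + x⁻¹) * x = x ^ 2 + 1 := by field_simp
    specialize ih (by lia)
    specialize ih' (by lia)
    rw [hrec k (by lia), Finset.sum_range_succ, Finset.sum_range_succ]
    rw [Finset.sum_range_succ] at ih'
    linear_combination u (k + 1) * x ^ (k + 1) * hxx + (x ^ 2 + 1) * ih' - x ^ 2 * ih

lemma sq_pow_eq_one_and_sq_ne_one_of_recurrence [CharZero K] {u : ℕ → K} {m : ℕ} {x : K}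
    (hx : x ≠ 0) (h0 : u 0 = 0) (hm : u (m + 1) = 0)
    (hrec : ∀ i < m, u (i + 2) = (x + x⁻¹) * u (i + 1) - u i) (hne : ∃ i ≤ m, u i ≠ 0) :
    (x ^ 2) ^ (m + 1) = 1 ∧ x ^ 2 ≠ 1 := by
  have hclosed {k : ℕ} := mul_pow_eq_geom_sum_of_recurrence hx h0 hrec (k := k)
  have hu1 : u 1 ≠ 0 := by
    intro hu1
    obtain ⟨i, hi, hui⟩ := hne
    refine mul_ne_zero hui (pow_ne_zero i hx) ?_
    rw [hclosed (by lia), hu1, zero_mul, zero_mul]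
  have hsum : ∑ i ∈ Finset.range (m + 1), (x ^ 2) ^ i = 0 := by
    have h := hclosed le_rfl
    rw [hm, zero_mul] at h
    exact (mul_eq_zero.1 h.symm).resolve_left (mul_ne_zero hu1 hx)
  constructor
  · have h := mul_neg_geom_sum (x ^ 2) (m + 1)
    rw [hsum, mul_zero] at h
    exact (sub_eq_zero.1 h.symm).symm
  · intro hx2
    simp only [hx2, one_pow, Finset.sum_const, Finset.card_range, nsmul_one] at hsum
    exact Nat.cast_ne_zero.2 m.succ_ne_zero hsum

end Field

section CommonEigenvector

variable {K V : Type*} [Field K] [IsAlgClosed K] [AddCommGroup V] [Module K V]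
  [FiniteDimensional K V]

lemma exists_hasEigenvector_mem {f : Module.End K V} {W : Submodule K V} (hW : W ≠ ⊥)
    (hf : ∀ w ∈ W, f w ∈ W) : ∃ a : K, ∃ w ∈ W, f.HasEigenvector a w := by
  have := Submodule.nontrivial_iff_ne_bot.2 hW
  obtain ⟨a, ha⟩ := Module.End.exists_eigenvalue (f.restrict hf)
  obtain ⟨w, hw⟩ := ha.exists_hasEigenvector
  exact ⟨a, w, w.2, Module.End.hasEigenvector_iff.2
    ⟨Module.End.mem_eigenspace_iff.2 (congrArg Subtype.val hw.apply_eq_smul),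
      fun h => hw.2 (Subtype.ext h)⟩⟩

lemma exists_common_eigenvector_of_commute {f g : Module.End K V} (hfg : Commute f g) {d : K}
    (hd : (f * g).HasEigenvalue d) :
    ∃ a b : K, ∃ w : V, f.HasEigenvector a w ∧ g.HasEigenvector b w ∧ a * b = d := by
  obtain ⟨a, w, hwd, hwa⟩ := exists_hasEigenvector_mem hd
    (Module.End.mapsTo_genEigenspace_of_comm ((Commute.refl f).mul_left hfg.symm) d 1)
  have hW : (f * g).eigenspace d ⊓ f.eigenspace a ≠ ⊥ :=
    Submodule.ne_bot_iff _ |>.2 ⟨w, ⟨hwd, hwa.1⟩, hwa.2⟩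
  obtain ⟨b, z, ⟨hzd, hza⟩, hzb⟩ := exists_hasEigenvector_mem (f := g) hW fun z hz =>
    ⟨Module.End.mapsTo_genEigenspace_of_comm (hfg.mul_left (Commute.refl g)) d 1 hz.1,
      Module.End.mapsTo_genEigenspace_of_comm hfg a 1 hz.2⟩
  refine ⟨a, b, z, ⟨hza, hzb.2⟩, hzb, smul_left_injective K hzb.2 ?_⟩
  have hfz : f z = a • z := Module.End.mem_eigenspace_iff.1 hza
  have hfgz : f (g z) = d • z := Module.End.mem_eigenspace_iff.1 hzd
  change (a * b) • z = d • z
  rw [← hfgz, hzb.apply_eq_smul, map_smul, hfz, smul_smul, mul_comm]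

end CommonEigenvector

section LoopedPath

/-- The adjacency matrix of the path on `m` vertices with a loop added at every vertex. Multiplying
a filling by it from the left replaces each entry by the sum over the closed neighbourhood in its
column. -/
def loopedPathMatrix (R : Type*) [Zero R] [One R] (m : ℕ) : Matrix (Fin m) (Fin m) R :=
  Matrix.of fun i j => if |(i : ℤ) - (j : ℤ)| ≤ 1 then 1 else 0

lemma loopedPathMatrix_transpose (R : Type*) [Zero R] [One R] (m : ℕ) :
    (loopedPathMatrix R m).transpose = loopedPathMatrix R m := by
  ext i j
  simp only [loopedPathMatrix, Matrix.transpose_apply, Matrix.of_apply, abs_sub_comm]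

lemma loopedPathMatrix_mulVec_apply {R : Type*} [NonAssocSemiring R] {m : ℕ} {u : ℕ → R}
    (h0 : u 0 = 0) (hm : u (m + 1) = 0) (i : Fin m) :
    (loopedPathMatrix R m).mulVec (fun k => u (k + 1)) i = u i + u (i + 1) + u (i + 2) := by
  let w : ℕ → R := fun k => if |(i : ℤ) + 1 - k| ≤ 1 then u k else 0
  have hw0 : w 0 = 0 := by simp only [w, h0, ite_self]
  have hwm : w (m + 1) = 0 := by simp only [w, hm, ite_self]
  calc (loopedPathMatrix R m).mulVec (fun k => u (k + 1)) i
      = ∑ k : Fin m, w (k + 1) := by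
        simp [loopedPathMatrix, Matrix.mulVec, dotProduct, w]
    _ = ∑ k ∈ Finset.range (m + 2), w k := by
        rw [Fin.sum_univ_eq_sum_range fun k => w (k + 1), Finset.sum_range_succ, hwm,
          Finset.sum_range_succ', hw0, add_zero, add_zero]
    _ = ∑ k ∈ Finset.Ico (i : ℕ) (i + 3), u k := by
        rw [← Finset.sum_filter]
        refine Finset.sum_congr (Finset.ext fun k => ?_) fun _ _ => rfl
        simp only [Finset.mem_filter, Finset.mem_range, Finset.mem_Ico, abs_le]
        have hi := i.2
        omega
    _ = u i + u (i + 1) + u (i + 2) := by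
        simp [Finset.sum_Ico_succ_top]

lemma exists_root_of_loopedPathMatrix_mulVec_eq_smul {K : Type*} [Field K] [IsAlgClosed K]
    [CharZero K] {m : ℕ} {w : Fin m → K} {c : K} (hw : w ≠ 0)
    (h : (loopedPathMatrix K m).mulVec w = c • w) :
    ∃ x : K, (x ^ 2) ^ (m + 1) = 1 ∧ x ^ 2 ≠ 1 ∧ 1 + (x + x⁻¹) = c := by
  obtain ⟨x, hx, hc⟩ := exists_add_inv_eq (c - 1)
  let u : ℕ → K := fun k => if hk : 1 ≤ k ∧ k ≤ m then w ⟨k - 1, by lia⟩ else 0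
  have h0 : u 0 = 0 := by simp [u]
  have hm : u (m + 1) = 0 := by simp [u]
  have huw : w = fun k : Fin m => u (k + 1) := by
    ext k
    simp [u, Nat.succ_le_of_lt k.2]
  have hrec : ∀ i < m, u (i + 2) = (x + x⁻¹) * u (i + 1) - u i := by
    intro i hi
    have hrow := congrFun h ⟨i, hi⟩
    rw [huw, loopedPathMatrix_mulVec_apply h0 hm, Pi.smul_apply, smul_eq_mul] at hrow
    linear_combination hrow - u (i + 1) * hc
  obtain ⟨i, hi⟩ := Function.ne_iff.1 hw
  obtain ⟨hroot, hx2⟩ := sq_pow_eq_one_and_sq_ne_one_of_recurrence hx h0 hm hrec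
    ⟨i + 1, i.2, by rwa [huw] at hi⟩
  exact ⟨x, hroot, hx2, by rw [hc, add_sub_cancel]⟩

lemma dvd_and_dvd_or_of_loopedPathMatrix_mul_mul {K : Type*} [Field K] [IsAlgClosed K] [CharZero K]
    {m n : ℕ} {M : Matrix (Fin m) (Fin n) K} (hM : M ≠ 0)
    (h : loopedPathMatrix K m * M * loopedPathMatrix K n = (2 : K) • M) :
    (2 ∣ m + 1 ∧ 3 ∣ n + 1) ∨ (3 ∣ m + 1 ∧ 2 ∣ n + 1) := by
  let f : Module.End K (Matrix (Fin m) (Fin n) K) :=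
    mulLeftLinearMap (Fin n) K (loopedPathMatrix K m)
  let g : Module.End K (Matrix (Fin m) (Fin n) K) :=
    mulRightLinearMap (Fin m) K (loopedPathMatrix K n)
  have hfg : Commute f g := LinearMap.ext fun Y => (Matrix.mul_assoc _ Y _).symm
  have hd : (f * g).HasEigenvalue 2 := Module.End.hasEigenvalue_of_hasEigenvector (x := M)
    ⟨Module.End.mem_eigenspace_iff.2 ((Matrix.mul_assoc _ _ _).symm.trans h), hM⟩
  obtain ⟨a, b, Y, ⟨hYa, hY⟩, ⟨hYb, -⟩, hab⟩ := exists_common_eigenvector_of_commute hfg hd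
  have hA : loopedPathMatrix K m * Y = a • Y := Module.End.mem_eigenspace_iff.1 hYa
  have hB : Y * loopedPathMatrix K n = b • Y := Module.End.mem_eigenspace_iff.1 hYb
  obtain ⟨i, hi⟩ := Function.ne_iff.1 hY
  obtain ⟨j, hij⟩ := Function.ne_iff.1 hi
  obtain ⟨x, hx, hx2, rfl⟩ := exists_root_of_loopedPathMatrix_mulVec_eq_smul
    (w := fun k => Y k j) (Function.ne_iff.2 ⟨i, hij⟩)
    (funext fun k => congrFun (congrFun hA k) j)
  obtain ⟨y, hy, hy2, rfl⟩ := exists_root_of_loopedPathMatrix_mulVec_eq_smul (w := Y i) (c := b)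
    hi (by
      rw [← loopedPathMatrix_transpose, Matrix.mulVec_transpose]
      exact congrFun hB i)
  exact dvd_and_dvd_or_of_one_add_mul_one_add_eq_two m.succ_ne_zero n.succ_ne_zero hx hy hx2 hy2 hab

lemma exists_loopedPathMatrix_mulVec_eq_self (R : Type*) [NonAssocRing R] [Nontrivial R] {m : ℕ}
    (h : 2 ∣ m + 1) : ∃ w : Fin m → R, w ≠ 0 ∧ (loopedPathMatrix R m).mulVec w = w := by
  let u : ℕ → ℤ := fun k => if k % 4 = 1 then 1 else if k % 4 = 3 then -1 else 0
  have hm : u (m + 1) = 0 := by simp only [u]; split_ifs <;> lia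
  have hrec (i : ℕ) : u i + u (i + 1) + u (i + 2) = u (i + 1) := by
    simp only [u]; split_ifs <;> lia
  refine ⟨fun k => (u (k + 1) : R), Function.ne_iff.2 ⟨⟨0, by lia⟩, by simp [u]⟩, ?_⟩
  ext i
  rw [loopedPathMatrix_mulVec_apply (u := fun k => (u k : R)) (by simp [u]) (by simp [hm])]
  exact_mod_cast congrArg (Int.cast : ℤ → R) (hrec i)

lemma exists_loopedPathMatrix_mulVec_eq_two_smul (R : Type*) [NonAssocRing R] [Nontrivial R] {m : ℕ}
    (h : 3 ∣ m + 1) : ∃ w : Fin m → R, w ≠ 0 ∧ (loopedPathMatrix R m).mulVec w = (2 : R) • w := by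
  let u : ℕ → ℤ := fun k => if k % 3 = 0 then 0 else if k % 6 < 3 then 1 else -1
  have hm : u (m + 1) = 0 := by simp only [u]; split_ifs <;> lia
  have hrec (i : ℕ) : u i + u (i + 1) + u (i + 2) = 2 * u (i + 1) := by
    simp only [u]; split_ifs <;> lia
  refine ⟨fun k => (u (k + 1) : R), Function.ne_iff.2 ⟨⟨0, by lia⟩, by simp [u]⟩, ?_⟩
  ext i
  rw [loopedPathMatrix_mulVec_apply (u := fun k => (u k : R)) (by simp [u]) (by simp [hm])]
  rw [Pi.smul_apply, smul_eq_mul]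
  exact_mod_cast congrArg (Int.cast : ℤ → R) (hrec i)

end LoopedPath

section NeighbourSum

variable {R : Type*} {m n : ℕ}

lemma filter_closed_neighbourhood_eq_insert (a : Cell m n) :
    ({b | |(a.1 : ℤ) - (b.1 : ℤ)| ≤ 1 ∧ |(a.2 : ℤ) - (b.2 : ℤ)| ≤ 1} : Finset (Cell m n)) =
      insert a ({b | IsNeighbour a b} : Finset (Cell m n)) := by
  ext b
  rw [Finset.mem_insert, Finset.mem_filter_univ, Finset.mem_filter_univ, IsNeighbour]
  rcases eq_or_ne a b with rfl | hab
  · simp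
  · simp [hab, hab.symm]

lemma loopedPathMatrix_mul_mul_apply [NonAssocSemiring R] (M : Matrix (Fin m) (Fin n) R)
    (a : Cell m n) : (loopedPathMatrix R m * M * loopedPathMatrix R n) a.1 a.2 =
      M a.1 a.2 + ∑ b with IsNeighbour a b, M b.1 b.2 := by
  calc (loopedPathMatrix R m * M * loopedPathMatrix R n) a.1 a.2
      = ∑ b : Cell m n, if |(a.1 : ℤ) - (b.1 : ℤ)| ≤ 1 ∧ |(a.2 : ℤ) - (b.2 : ℤ)| ≤ 1
          then M b.1 b.2 else 0 := by
        rw [← loopedPathMatrix_transpose R n, Fintype.sum_prod_type_right]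
        simp only [Matrix.mul_apply, Matrix.transpose_apply, Finset.sum_mul]
        refine Finset.sum_congr rfl fun j _ => Finset.sum_congr rfl fun i _ => ?_
        simp only [loopedPathMatrix, Matrix.of_apply, ite_and, ite_mul, mul_ite, one_mul, mul_one,
          zero_mul, mul_zero]
        split_ifs <;> rfl
    _ = M a.1 a.2 + ∑ b with IsNeighbour a b, M b.1 b.2 := by
        rw [← Finset.sum_filter, filter_closed_neighbourhood_eq_insert,
          Finset.sum_insert fun ha => (Finset.mem_filter_univ a |>.1 ha).1 rfl]

lemma forall_eq_sum_isNeighbour_iff [Ring R] {X : Cell m n → R} :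
    (∀ a, X a = ∑ b with IsNeighbour a b, X b) ↔
      loopedPathMatrix R m * Matrix.of (Function.curry X) * loopedPathMatrix R n =
        (2 : R) • Matrix.of (Function.curry X) := by
  rw [← Matrix.ext_iff, Prod.forall]
  refine forall₂_congr fun i j => ?_
  have happly := loopedPathMatrix_mul_mul_apply (Matrix.of (Function.curry X)) (i, j)
  rw [happly, two_smul, Matrix.add_apply, add_right_inj, eq_comm]
  rfl

lemma exists_forall_eq_sum_isNeighbour_of_mulVec [CommRing R] [NoZeroDivisors R] {w : Fin m → R}
    {z : Fin n → R} {a b : R} (hw : w ≠ 0) (hz : z ≠ 0)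
    (hwa : (loopedPathMatrix R m).mulVec w = a • w)
    (hzb : (loopedPathMatrix R n).mulVec z = b • z) (hab : a * b = 2) :
    ∃ X : Cell m n → R, (∀ c, X c = ∑ d with IsNeighbour c d, X d) ∧ X ≠ 0 := by
  refine ⟨fun c => w c.1 * z c.2, forall_eq_sum_isNeighbour_iff.2 ?_, ?_⟩
  · change loopedPathMatrix R m * Matrix.vecMulVec w z * loopedPathMatrix R n =
      (2 : R) • Matrix.vecMulVec w z
    rw [Matrix.mul_vecMulVec, Matrix.vecMulVec_mul, hwa, ← Matrix.mulVec_transpose,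
      loopedPathMatrix_transpose, hzb, Matrix.smul_vecMulVec, Matrix.vecMulVec_smul, smul_smul, hab]
  · obtain ⟨i, hi⟩ := Function.ne_iff.1 hw
    obtain ⟨j, hj⟩ := Function.ne_iff.1 hz
    exact Function.ne_iff.2 ⟨(i, j), mul_ne_zero hi hj⟩

lemma dvd_and_dvd_or_of_forall_eq_sum_isNeighbour {K : Type*} [Ring R] [Field K]
    [IsAlgClosed K] [CharZero K] {φ : R →+* K} (hφ : Function.Injective φ) {X : Cell m n → R}
    (hX : ∀ a, X a = ∑ b with IsNeighbour a b, X b) (hX0 : X ≠ 0) :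
    (2 ∣ m + 1 ∧ 3 ∣ n + 1) ∨ (3 ∣ m + 1 ∧ 2 ∣ n + 1) := by
  have hφX : ∀ a, φ (X a) = ∑ b with IsNeighbour a b, φ (X b) := fun a => by
    rw [← map_sum, ← hX a]
  obtain ⟨⟨i, j⟩, hij⟩ := Function.ne_iff.1 hX0
  have hM : Matrix.of (Function.curry fun a => φ (X a)) ≠ 0 := fun h =>
    (map_ne_zero_iff φ hφ).2 hij (congrFun (congrFun h i) j)
  exact dvd_and_dvd_or_of_loopedPathMatrix_mul_mul hM (forall_eq_sum_isNeighbour_iff.1 hφX)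

end NeighbourSum

theorem mainTheorem3_general (R : Type*) [CommRing R] [IsDomain R] [CharZero R] (m n : ℕ) :
    (∃ X : Cell m n → R, (∀ a, X a = ∑ b with IsNeighbour a b, X b) ∧ X ≠ 0) ↔
      (2 ∣ m + 1 ∧ 3 ∣ n + 1) ∨ (3 ∣ m + 1 ∧ 2 ∣ n + 1) := by
  constructor
  · rintro ⟨X, hX, hX0⟩
    have hinj : Function.Injective ((algebraMap (FractionRing R)
        (AlgebraicClosure (FractionRing R))).comp (algebraMap R (FractionRing R))) :=
      (algebraMap (FractionRing R) _).injective.comp (IsFractionRing.injective R _)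
    have := charZero_of_injective_ringHom hinj
    exact dvd_and_dvd_or_of_forall_eq_sum_isNeighbour hinj hX hX0
  rintro (⟨h2, h3⟩ | ⟨h3, h2⟩)
  all_goals
    obtain ⟨w, hw0, hw⟩ := exists_loopedPathMatrix_mulVec_eq_self R h2
    obtain ⟨z, hz0, hz⟩ := exists_loopedPathMatrix_mulVec_eq_two_smul R h3
    have hwone := hw.trans (one_smul R w).symm
  · exact exists_forall_eq_sum_isNeighbour_of_mulVec hw0 hz0 hwone hz (one_mul 2)
  · exact exists_forall_eq_sum_isNeighbour_of_mulVec hz0 hw0 hz hwone (mul_one 2)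

theorem mainTheorem3 (m n : ℕ) (hm : 2 ≤ m) (hn : 2 ≤ n) :
    (∃ X : Cell m n → ℤ, NeighbourSum X ∧ X ≠ 0) ↔
      (2 ∣ m + 1 ∧ 3 ∣ n + 1) ∨ (3 ∣ m + 1 ∧ 2 ∣ n + 1) :=
  mainTheorem3_general ℤ m n
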